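/- Let $K$ be a field, $n\ge 0$, $t\in K$, $\mathbf x=(x_1,\dots,x_n)$ and $\mathbf y=(y_1,\dots,y_n)$ with entries in $K$, such that the $x_i$ are distinct and non-zero, the $y_j$ are distinct, and $x_iy_j\neq 1$, $t\,x_iy_j\neq 1$ for all $i,j$. (For instance $t,x_1,\dots,x_n,y_1,\dots,y_n$ may be indeterminates and $K$ their field of rational functions.) On functions $f$ of $n$ variables define the operators, written on the right and applied from left to right, $$ (f\tau_0)(x_1,\dots,x_n)=f(x_2,\dots,x_n,0),\qquad f\sqcap_\omega=\sum_{w\in\mathfrak S_n}\Bigl(f\prod_{i<j}\frac{t x_i-x_j}{x_i-x_j}\Bigr)^{w}, $$ where $w$ acts by permuting the variables $x_1,\dots,x_n$. Let $$\sigma_1(\mathbf x\mathbf y)=\prod_{i,j}\frac1{1-x_iy_j},\qquad \sigma_1(\mathbf x\mathbf y(1-t))=\prod_{i,j}\frac{1-t x_iy_j}{1-x_iy_j},\qquad [n]!=(1-t)(1-t^2)\cdots(1-t^n),$$ the second being the Cauchy kernel of the Hall–Littlewood polynomials. Let $$F^1_n(\mathbf x,\mathbf y)=\frac{\prod_{i,j}(x_i-y_j)(x_i-ty_j)}{\prod_{i<j}(x_j-x_i)\,\prod_{i<j}(y_i-y_j)}\;\det\Bigl(\frac1{(x_i-y_j)(x_i-ty_j)}\Bigr)_{i,j=1,\dots,n}$$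 be the Gaudin function of level $1$, and $\widetilde F^1_n(\mathbf x,\mathbf y)=(x_1\cdots x_n)^{n-1}F^1_n(\mathbf x^\vee,\mathbf y)$ with $\mathbf x^\vee=(x_1^{-1},\dots,x_n^{-1})$. Then $$\sigma_1(\mathbf x\mathbf y(1-t))\,(1-t\tau_0)(1-t^2\tau_0)\cdots(1-t^n\tau_0)\,\sqcap_\omega=\sigma_1(\mathbf x\mathbf y)\;\widetilde F^1_n(\mathbf x,\mathbf y)\;[n]!\,,$$ where the operators act on $\sigma_1(\mathbf x\mathbf y(1-t))$ as a function of $\mathbf x$. -/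

import Mathlib

open Finset

namespace Lascoux

/-! Everything is carried out in a field `K`. A "function of the alphabet `x = (x₁, …, xₙ)`" is a
function `(Fin n → K) → K`; taking for `K` the field of rational functions in the indeterminates
`t, x₁, …, xₙ, y₁, …, yₙ` and evaluating at the indeterminates gives the identities between
rational functions. Operators act on functions of `x`; they are written on the right in the
usual notation, `f A B` meaning "first `A`, then `B`". -/

variable {K : Type*} [Field K] {n : ℕ}

/-- The alphabet `(x₂, …, xₙ, q x₁)`: the indices of the letters are incremented, with the
periodicity `x_{i+n} = q x_i`. -/
def shift (q : K) (x : Fin n → K) : Fin n → K := fun i =>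
  if h : (i : ℕ) + 1 < n then x ⟨(i : ℕ) + 1, h⟩ else q * x ⟨0, i.pos⟩

/-- The operator `τ_q`: `(f τ_q)(x₁, …, xₙ) = f(x₂, …, xₙ, q x₁)`. -/
def tau (q : K) (f : (Fin n → K) → K) : (Fin n → K) → K := fun x => f (shift q x)

/-- `f (1 - t τ_q)(1 - t² τ_q) ⋯ (1 - tᵐ τ_q)`. -/
def applyFactors (q t : K) (f : (Fin n → K) → K) : ℕ → ((Fin n → K) → K)
  | 0 => f
  | m + 1 => fun x =>
      applyFactors q t f m x - t ^ (m + 1) * tau q (applyFactors q t f m) x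

/-- The Euler-Poincaré characteristic
`f ⊓_ω = ∑_w (f ∏_{i<j} (t x_i - x_j) / (x_i - x_j))^w`, sum over the symmetric group, a permutation
`w` acting on functions by permuting the variables. -/
def eulerPoincare (t : K) (f : (Fin n → K) → K) : (Fin n → K) → K := fun x =>
  ∑ w : Equiv.Perm (Fin n),
    f (x ∘ w) * ∏ i : Fin n, ∏ j ∈ Ioi i, (t * x (w i) - x (w j)) / (x (w i) - x (w j))

/-- The Cauchy kernel `σ₁(xy) = ∏_{i,j} 1 / (1 - x_i y_j)`. -/
def cauchyKernel (y x : Fin n → K) : K := ∏ i, ∏ j, 1 / (1 - x i * y j)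

/-- The Hall-Littlewood Cauchy kernel `σ₁(xy(1-t)) = ∏_{i,j} (1 - t x_i y_j) / (1 - x_i y_j)`,
a function of `x`. -/
def hallLittlewoodKernel (t : K) (y x : Fin n → K) : K :=
  ∏ i, ∏ j, (1 - t * (x i * y j)) / (1 - x i * y j)

/-- The Gaudin function `F^r_n(x, y)` of level `r`:
the determinant of `1 / ((x_i - y_j)(x_i - t y_j) ⋯ (x_i - t^r y_j))`, multiplied by
`∏_{i,j} (x_i - y_j) ⋯ (x_i - t^r y_j)` and divided by the two Vandermonde products. The latter
are taken in the opposite orders `∏_{i<j} (x_j - x_i)` and `∏_{i<j} (y_i - y_j)`, so that for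
`r = 0` (the Cauchy determinant) the quotient is `1`. -/
def gaudin (r : ℕ) (t : K) (x y : Fin n → K) : K :=
  (∏ i, ∏ j, ∏ k ∈ range (r + 1), (x i - t ^ k * y j)) /
      ((∏ i : Fin n, ∏ j ∈ Ioi i, (x j - x i)) * (∏ i : Fin n, ∏ j ∈ Ioi i, (y i - y j))) *
    Matrix.det (Matrix.of fun i j : Fin n => 1 / ∏ k ∈ range (r + 1), (x i - t ^ k * y j))

/-- `F̃¹_n(x, y) = (x₁ ⋯ xₙ)^{n-1} F¹_n(x^∨, y)`, where `x^∨ = (x₁⁻¹, …, xₙ⁻¹)`. -/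
def gaudinTilde (t : K) (x y : Fin n → K) : K :=
  (∏ i, x i) ^ (n - 1) * gaudin 1 t (fun i => (x i)⁻¹) y

/-- `[n]! = (1 - t)(1 - t²) ⋯ (1 - tⁿ)`. -/
def qFactorial (t : K) (n : ℕ) : K := ∏ k ∈ range n, (1 - t ^ (k + 1))

end Lascoux

/-! Both sides reduce to one sum over subsets `T` of the letters. Its term carries (-1)^k
t^(k(k+1)/2) with k = #T, the cross factors (t x_a - x_b)/(x_a - x_b) for a in `T` and b outside,
and the kernel of the letters outside `T`.

On the left, the t-binomial theorem (`factorsCoeff_mul_geomFactorial`) turns the product of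
operators into a combination of the powers τ_0^k, and τ_0^k deletes k letters from the kernel.
Orderings are grouped by the set `T` of their first k letters; reordering inside `T` and inside its
complement produces t-factorials (`sum_perm_eq_subsetSum`), which absorb the denominators of the
t-binomials.

On the right, (1-t)/((1-u)(1-tu)) = 1/(1-u) - t/(1-tu) splits every row of the Gaudin determinant.
Multilinearity gives a sum over `T` of Cauchy determinants with x_a replaced by t x_a for a in `T`
(`det_one_div_mul_expansion`); the modified Vandermonde supplies the cross factors
(`prod_Ioi_scaled_sub`). -/

namespace Lascoux

/-! ### The Cauchy determinant -/

/-- The Cauchy determinant `det (1 / (1 - aᵢ yⱼ))`. -/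
theorem det_one_div_one_sub_mul {K : Type*} [Field K] :
    ∀ (n : ℕ) (a y : Fin n → K), (∀ i j, 1 - a i * y j ≠ 0) →
      Matrix.det (Matrix.of fun i j => 1 / (1 - a i * y j)) =
        (∏ i : Fin n, ∏ j ∈ Ioi i, (a i - a j)) * (∏ i : Fin n, ∏ j ∈ Ioi i, (y i - y j)) /
          ∏ i, ∏ j, (1 - a i * y j) := by
  intro n
  induction n with
  | zero => intro a y _; simp
  | succ n ih =>
    intro a y h
    -- Clearing column 0 with row 0 leaves an n × n block which is again a Cauchy matrix, up to one
    -- factor per row and one per column.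
    let B : Matrix (Fin (n + 1)) (Fin (n + 1)) K := Matrix.of fun i j =>
      if i = 0 then 1 / (1 - a 0 * y j)
      else 1 / (1 - a i * y j) - (1 - a 0 * y 0) / (1 - a i * y 0) * (1 / (1 - a 0 * y j))
    have hdet : Matrix.det (Matrix.of fun i j => 1 / (1 - a i * y j)) = B.det := by
      refine Matrix.det_eq_of_forall_row_eq_smul_add_const
        (fun i => if i = 0 then 0 else (1 - a 0 * y 0) / (1 - a i * y 0)) 0 (by simp) ?_
      intro i j
      by_cases hi : i = 0
      · subst hi; simp [B]
      · simp [B, hi]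
    have hB0 : ∀ i : Fin n, B i.succ 0 = 0 := by
      intro i
      have h1 := h i.succ 0
      have h2 := h 0 0
      simp only [B, Matrix.of_apply, Fin.succ_ne_zero, if_false]
      rw [div_mul_div_comm, mul_one, div_mul_cancel_right₀ h2, one_div, sub_self]
    have hsub : B.submatrix (Fin.succAbove 0) Fin.succ = Matrix.of fun i j =>
        ((a 0 - a i.succ) / (1 - a i.succ * y 0)) *
          (Matrix.of (fun i j => ((y 0 - y j.succ) / (1 - a 0 * y j.succ)) *
            (Matrix.of (fun i j => 1 / (1 - a i.succ * y j.succ)) : Matrix (Fin n) (Fin n) K) i j) :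
            Matrix (Fin n) (Fin n) K) i j := by
      ext i j
      have h1 := h i.succ 0
      have h2 := h 0 j.succ
      have h3 := h i.succ j.succ
      simp only [B, Matrix.of_apply, Matrix.submatrix_apply, Fin.succAbove_zero,
        Fin.succ_ne_zero, if_false]
      generalize a 0 = p, a i.succ = q, y 0 = r, y j.succ = s at *
      rw [div_mul_div_comm, div_mul_div_comm, div_mul_div_comm, div_sub_div _ _ h3 (mul_ne_zero h1 h2),
        div_eq_div_iff (by positivity) (by positivity)]
      ring
    rw [hdet, Matrix.det_succ_column_zero, Fin.sum_univ_succ]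
    simp only [hB0, mul_zero, zero_mul, sum_const_zero, add_zero]
    rw [hsub, Matrix.det_mul_column, Matrix.det_mul_row,
      ih (fun i => a i.succ) (fun i => y i.succ) fun i j => h _ _]
    simp only [Fin.prod_univ_succ (n := n), Fin.prod_Ioi_zero, Fin.prod_Ioi_succ, prod_mul_distrib,
      prod_div_distrib]
    simp only [B, Matrix.of_apply, if_true, Fin.val_zero, pow_zero, one_mul]
    have h1 := h 0 0
    have h2 : ∏ i : Fin n, (1 - a i.succ * y 0) ≠ 0 := prod_ne_zero_iff.2 fun i _ => h _ _
    have h3 : ∏ i : Fin n, (1 - a 0 * y i.succ) ≠ 0 := prod_ne_zero_iff.2 fun i _ => h _ _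
    have h4 : ∏ i : Fin n, ∏ j : Fin n, (1 - a i.succ * y j.succ) ≠ 0 :=
      prod_ne_zero_iff.2 fun i _ => prod_ne_zero_iff.2 fun j _ => h _ _
    field_simp

/-! ### Symmetrization over orderings -/

-- Lagrange interpolation of P = ∏ (tX - b) at the nodes S ∪ {0}: the coefficient t^#S is 1 (from
-- the node 0) plus (t - 1) times the sum. The extra node cancels the factor a in ta - a = a(t - 1).
-- Dividing by t - 1 requires treating t = 1 apart.
open Polynomial in
theorem sum_prod_erase_mul_sub_div_sub_of_zero_notMem {K : Type*} [Field K] [DecidableEq K]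
    (t : K) (S : Finset K) (h0 : (0 : K) ∉ S) :
    ∑ a ∈ S, ∏ b ∈ S.erase a, (t * a - b) / (a - b) = ∑ i ∈ range #S, t ^ i := by
  by_cases ht : t = 1
  · subst ht
    have : ∀ a ∈ S, ∏ b ∈ S.erase a, (1 * a - b) / (a - b) = 1 := by
      intro a _
      refine prod_eq_one fun b hb => ?_
      rw [one_mul, div_self]
      exact sub_ne_zero.2 (ne_of_mem_erase hb).symm
    rw [sum_congr rfl this]
    simp
  · have ht' : t - 1 ≠ 0 := sub_ne_zero.2 ht
    let P : K[X] := ∏ b ∈ S, (C t * X - C b)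
    have hlin : ∀ b : K, (C t * X - C b).natDegree ≤ 1 := fun b => by
      rw [sub_eq_add_neg, ← C_neg]; exact natDegree_linear_le
    have hdeg : P.natDegree ≤ #S := by
      refine (natDegree_prod_le _ _).trans ?_
      refine (sum_le_sum fun b _ => hlin b).trans ?_
      simp
    have hcoeff : P.coeff (#S) = t ^ #S := by
      have := coeff_prod_of_natDegree_le S (fun b => C t * X - C b) 1 fun b _ => hlin b
      rw [mul_one] at this
      rw [this]
      simp [coeff_C]
    have hcard : #(insert 0 S) = #S + 1 := card_insert_of_notMem h0
    have hP : P.degree < #(insert 0 S) := by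
      rw [hcard]
      refine degree_le_natDegree.trans_lt ?_
      exact_mod_cast Nat.lt_succ_of_le hdeg
    have key := Lagrange.coeff_eq_sum (s := insert 0 S) (v := id) Function.injective_id.injOn hP
    rw [hcard, Nat.add_sub_cancel, hcoeff, sum_insert h0, erase_insert h0] at key
    have hz : eval (id 0) P / ∏ j ∈ S, (id 0 - id j) = 1 := by
      simp only [P, eval_prod, id]
      rw [← prod_div_distrib]
      refine prod_eq_one fun b hb => ?_
      have : b ≠ 0 := fun h => h0 (h ▸ hb)
      simp [this]
    have hs : ∀ a ∈ S, eval (id a) P / ∏ j ∈ (insert 0 S).erase a, (id a - id j) =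
        (t - 1) * ∏ b ∈ S.erase a, (t * a - b) / (a - b) := by
      intro a ha
      have ha0 : a ≠ 0 := fun h => h0 (h ▸ ha)
      rw [erase_insert_of_ne ha0.symm, prod_insert (fun h => h0 (mem_of_mem_erase h)),
        prod_div_distrib]
      simp only [P, eval_prod, id, sub_zero]
      rw [← mul_prod_erase _ _ ha]
      simp only [eval_sub, eval_mul, eval_C, eval_X]
      rw [show t * a - a = a * (t - 1) by ring, mul_assoc, mul_div_mul_left _ _ ha0, mul_div_assoc]
    rw [hz, sum_congr rfl hs, ← mul_sum] at key
    refine mul_left_cancel₀ ht' ?_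
    rw [mul_geom_sum, key]
    ring

theorem sum_prod_erase_mul_sub_div_sub {K ι : Type*} [Field K] [DecidableEq ι] (t : K) (x : ι → K)
    (hx : Function.Injective x) (hx0 : ∀ i, x i ≠ 0) (S : Finset ι) :
    ∑ a ∈ S, ∏ b ∈ S.erase a, (t * x a - x b) / (x a - x b) = ∑ i ∈ range #S, t ^ i := by
  classical
  have := sum_prod_erase_mul_sub_div_sub_of_zero_notMem t (S.image x) (by simp [hx0])
  rw [card_image_of_injective _ hx, sum_image hx.injOn] at this
  rw [← this]
  refine sum_congr rfl fun a _ => ?_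
  rw [← image_erase hx, prod_image hx.injOn]

/-- `[m]! / (1 - t)^m = ∏_{i < m} (1 + t + ⋯ + t^i)`, a polynomial in `t`. -/
def geomFactorial {K : Type*} [Field K] (t : K) (m : ℕ) : K :=
  ∏ i ∈ range m, ∑ j ∈ range (i + 1), t ^ j

theorem geomFactorial_succ {K : Type*} [Field K] (t : K) (m : ℕ) :
    geomFactorial t (m + 1) = geomFactorial t m * ∑ j ∈ range (m + 1), t ^ j :=
  prod_range_succ _ _

theorem qFactorial_eq {K : Type*} [Field K] (t : K) (m : ℕ) :
    qFactorial t m = (1 - t) ^ m * geomFactorial t m := by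
  simp only [qFactorial, geomFactorial, ← mul_neg_geom_sum, prod_mul_distrib, prod_const,
    card_range]

/-- The `k`-th graded piece `∑_{#T = k} ∏_{a ∈ T, b ∈ A \ T} g a b ∏_{b ∈ A \ T} h b`. -/
def subsetSum {K ι : Type*} [Field K] [DecidableEq ι] (g : ι → ι → K) (h : ι → K) (A : Finset ι)
    (k : ℕ) : K :=
  ∑ T ∈ powersetCard k A, (∏ a ∈ T, ∏ b ∈ A \ T, g a b) * ∏ b ∈ A \ T, h b

section

variable {K ι : Type*} [Field K] [DecidableEq ι] (g : ι → ι → K) (h : ι → K)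

theorem subsetSum_zero (A : Finset ι) : subsetSum g h A 0 = ∏ b ∈ A, h b := by
  simp [subsetSum]

/-- Double counting of pairs (`T`, a) with a in `T` and #T = k + 1: the factors g a b with b in `T`
sum to c (k + 1) over a, while those with b outside `T` complete the cross product of `T.erase a` to
that of `T`. -/
theorem sum_mul_subsetSum_erase (c : ℕ → K)
    (hc : ∀ S : Finset ι, ∑ a ∈ S, ∏ b ∈ S.erase a, g a b = c #S) (A : Finset ι) (k : ℕ) :
    ∑ a ∈ A, (∏ b ∈ A.erase a, g a b) * subsetSum g h (A.erase a) k =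
      c (k + 1) * subsetSum g h A (k + 1) := by
  have h1 : c (k + 1) * subsetSum g h A (k + 1) =
      ∑ T ∈ powersetCard (k + 1) A, ∑ a ∈ T, (∏ b ∈ T.erase a, g a b) *
        ((∏ a ∈ T, ∏ b ∈ A \ T, g a b) * ∏ b ∈ A \ T, h b) := by
    rw [subsetSum, mul_sum]
    refine sum_congr rfl fun T hT => ?_
    rw [← sum_mul, hc, (mem_powersetCard.1 hT).2]
  rw [h1]
  simp only [subsetSum, mul_sum]
  rw [sum_sigma', sum_sigma']
  refine sum_bij' (fun p _ => ⟨insert p.1 p.2, p.1⟩) (fun p _ => ⟨p.2, p.1.erase p.2⟩)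
    ?_ ?_ ?_ ?_ ?_
  · rintro ⟨a, T⟩ hp
    simp only [mem_sigma, mem_powersetCard] at hp ⊢
    obtain ⟨ha, hT, hk⟩ := hp
    have haT : a ∉ T := fun h => notMem_erase a A (hT h)
    exact ⟨⟨insert_subset ha (hT.trans (erase_subset _ _)), by rw [card_insert_of_notMem haT, hk]⟩,
      mem_insert_self _ _⟩
  · rintro ⟨T, a⟩ hp
    simp only [mem_sigma, mem_powersetCard] at hp ⊢
    obtain ⟨⟨hT, hk⟩, ha⟩ := hp
    exact ⟨hT ha, erase_subset_erase _ hT, by rw [card_erase_of_mem ha, hk]; rfl⟩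
  · rintro ⟨a, T⟩ hp
    simp only [mem_sigma, mem_powersetCard] at hp
    have haT : a ∉ T := fun h => notMem_erase a A (hp.2.1 h)
    simp [erase_insert haT]
  · rintro ⟨T, a⟩ hp
    simp only [mem_sigma, mem_powersetCard] at hp
    simp [insert_erase hp.2]
  · rintro ⟨a, T⟩ hp
    simp only [mem_sigma, mem_powersetCard] at hp
    obtain ⟨ha, hT, hk⟩ := hp
    have haT : a ∉ T := fun h => notMem_erase a A (hT h)
    have hs : A \ insert a T = A.erase a \ T := by
      ext b; simp only [mem_sdiff, mem_insert, mem_erase]; tauto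
    simp only [erase_insert haT, hs]
    rw [prod_insert haT, ← prod_sdiff hT]
    ring

/-- Symmetrization over all orderings of the letters `v 0, …, v (m-1)`, of which the last `m - k`
carry the weight `h`. -/
theorem sum_perm_eq_subsetSum (t : K)
    (hc : ∀ S : Finset ι, ∑ a ∈ S, ∏ b ∈ S.erase a, g a b = ∑ j ∈ range #S, t ^ j) :
    ∀ (m k : ℕ) (v : Fin m → ι), k ≤ m → Function.Injective v →
      ∑ w : Equiv.Perm (Fin m), (∏ i : Fin m, if k ≤ (i : ℕ) then h (v (w i)) else 1) *
          ∏ i : Fin m, ∏ j ∈ Ioi i, g (v (w i)) (v (w j)) =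
        geomFactorial t k * geomFactorial t (m - k) * subsetSum g h (univ.image v) k := by
  intro m
  induction m with
  | zero =>
    intro k v hk _
    obtain rfl : k = 0 := by omega
    simp [geomFactorial, subsetSum_zero]
  | succ m ih =>
    intro k v hk hv
    have himg : ∀ p : Fin (m + 1), (univ.image fun i : Fin m => v (Equiv.swap 0 p i.succ)) =
        (univ.image v).erase (v p) := by
      intro p
      ext b
      simp only [mem_image, mem_univ, true_and, mem_erase]
      constructor
      · rintro ⟨i, rfl⟩
        refine ⟨fun hh => ?_, _, rfl⟩
        have := hv hh
        rw [Equiv.swap_apply_eq_iff, Equiv.swap_apply_right] at this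
        exact Fin.succ_ne_zero _ this
      · rintro ⟨hne, q, rfl⟩
        have hq : Equiv.swap 0 p q ≠ 0 := by
          intro hh
          rw [Equiv.swap_apply_eq_iff, Equiv.swap_apply_left] at hh
          exact hne (hh ▸ rfl)
        obtain ⟨i, hi⟩ := Fin.exists_succ_eq.2 hq
        exact ⟨i, by rw [hi, Equiv.swap_apply_self]⟩
    have hinj : ∀ p : Fin (m + 1), Function.Injective fun i : Fin m => v (Equiv.swap 0 p i.succ) :=
      fun p => hv.comp ((Equiv.swap 0 p).injective.comp (Fin.succ_injective _))
    have hcross : ∀ (p : Fin (m + 1)) (e : Equiv.Perm (Fin m)),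
        ∏ j : Fin m, g (v p) (v (Equiv.swap 0 p (e j).succ)) =
          ∏ b ∈ (univ.image v).erase (v p), g (v p) b := by
      intro p e
      rw [← himg, prod_image (hinj p).injOn]
      exact Equiv.prod_comp e fun j => g (v p) (v (Equiv.swap 0 p j.succ))
    have hterm : ∀ (p : Fin (m + 1)) (e : Equiv.Perm (Fin m)),
        (∏ i : Fin (m + 1), if k ≤ (i : ℕ) then
            h (v (Equiv.Perm.decomposeFin.symm (p, e) i)) else 1) *
          (∏ i : Fin (m + 1), ∏ j ∈ Ioi i, g (v (Equiv.Perm.decomposeFin.symm (p, e) i))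
            (v (Equiv.Perm.decomposeFin.symm (p, e) j))) =
        ((if k = 0 then h (v p) else 1) * ∏ b ∈ (univ.image v).erase (v p), g (v p) b) *
        ((∏ i : Fin m, if k - 1 ≤ (i : ℕ) then h (v (Equiv.swap 0 p (e i).succ)) else 1) *
          ∏ i : Fin m, ∏ j ∈ Ioi i, g (v (Equiv.swap 0 p (e i).succ))
            (v (Equiv.swap 0 p (e j).succ))) := by
      intro p e
      simp only [Fin.prod_univ_succ (n := m), Fin.prod_Ioi_zero, Fin.prod_Ioi_succ,
        Equiv.Perm.decomposeFin_symm_apply_zero, Equiv.Perm.decomposeFin_symm_apply_succ, hcross,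
        Fin.val_zero, Nat.le_zero, Fin.val_succ, Nat.sub_le_iff_le_add]
      ring
    -- Orderings are sorted by their first letter v p; the rest is an ordering of the other letters.
    rw [← Equiv.sum_comp Equiv.Perm.decomposeFin.symm, Fintype.sum_prod_type]
    simp only [hterm, ← mul_sum]
    have hstep := fun p => ih (k - 1) (fun i : Fin m => v (Equiv.swap 0 p i.succ)) (by omega)
      (hinj p)
    simp only [himg] at hstep
    simp only [hstep]
    rw [← sum_image (s := univ) (g := v) (f := fun a =>
      ((if k = 0 then h a else 1) * ∏ b ∈ (univ.image v).erase a, g a b) *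
        (geomFactorial t (k - 1) * geomFactorial t (m - (k - 1)) *
          subsetSum g h ((univ.image v).erase a) (k - 1))) hv.injOn]
    have hcard : #(univ.image v) = m + 1 := by
      rw [card_image_of_injective _ hv, card_univ, Fintype.card_fin]
    -- For k = 0 the first letter carries h, and `hc` on the whole alphabet gives the new t-integer;
    -- otherwise it joins `T`, and the double counting applies.
    rcases k with _ | k
    · simp only [subsetSum_zero, if_true, Nat.zero_sub, Nat.sub_zero, geomFactorial_succ t m]
      have hgeom := hc (univ.image v)
      rw [hcard] at hgeom
      rw [← hgeom, mul_sum, mul_sum, sum_mul]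
      refine sum_congr rfl fun a ha => ?_
      rw [← mul_prod_erase _ _ ha]
      ring
    · have := sum_mul_subsetSum_erase g h (fun l => ∑ j ∈ range l, t ^ j) hc (univ.image v) k
      simp only [Nat.add_sub_cancel, Nat.succ_ne_zero, if_false, one_mul, Nat.add_sub_add_right,
        geomFactorial_succ t k]
      rw [mul_right_comm (geomFactorial t k), mul_assoc _ _ (subsetSum _ _ _ _), ← this, mul_sum]
      refine sum_congr rfl fun a _ => ?_
      ring

end

/-! ### Expansion of the operators in powers of τ_0 -/

/-- The coefficient of `X ^ k` in `(1 - t X)(1 - t² X) ⋯ (1 - tᵐ X)`. -/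
def factorsCoeff {K : Type*} [Field K] (t : K) : ℕ → ℕ → K
  | 0, 0 => 1
  | 0, _ + 1 => 0
  | m + 1, 0 => factorsCoeff t m 0
  | m + 1, k + 1 => factorsCoeff t m (k + 1) - t ^ (m + 1) * factorsCoeff t m k

theorem factorsCoeff_zero_right {K : Type*} [Field K] (t : K) (m : ℕ) :
    factorsCoeff t m 0 = 1 := by
  induction m with
  | zero => rfl
  | succ m ih => exact ih

theorem factorsCoeff_of_lt {K : Type*} [Field K] (t : K) (m : ℕ) :
    ∀ k, m < k → factorsCoeff t m k = 0 := by
  induction m with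
  | zero =>
    intro k hk
    obtain ⟨k, rfl⟩ := Nat.exists_eq_succ_of_ne_zero hk.ne'
    rfl
  | succ m ih =>
    intro k hk
    obtain ⟨k, rfl⟩ := Nat.exists_eq_succ_of_ne_zero (by omega : k ≠ 0)
    simp only [factorsCoeff]
    rw [ih _ (by omega), ih _ (by omega)]
    ring

/-- The t-binomial theorem, by the t-Pascal rule. Denominators are cleared because `geomFactorial`
can vanish when t is a root of unity. -/
theorem factorsCoeff_mul_geomFactorial {K : Type*} [Field K] (t : K) (m : ℕ) :
    ∀ k, k ≤ m → factorsCoeff t m k * (geomFactorial t k * geomFactorial t (m - k)) =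
      (-1) ^ k * t ^ (k + 1).choose 2 * geomFactorial t m := by
  induction m with
  | zero =>
    intro k hk
    obtain rfl : k = 0 := by omega
    simp [factorsCoeff, geomFactorial]
  | succ m ih =>
    intro k hk
    rcases k with _ | k
    · simp [factorsCoeff_zero_right, geomFactorial]
    · have hch : (k + 1 + 1).choose 2 = k + 1 + (k + 1).choose 2 := by
        rw [Nat.choose_succ_succ' (k + 1) 1, Nat.choose_one_right]
      have hk' : k ≤ m := by omega
      have h2 := ih k hk'
      simp only [factorsCoeff, Nat.add_sub_add_right]
      have hsum : ∑ j ∈ range (m + 1), t ^ j =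
          ∑ j ∈ range (m - k), t ^ j + t ^ (m - k) * ∑ j ∈ range (k + 1), t ^ j := by
        rw [show m + 1 = (m - k) + (k + 1) by omega, sum_range_add, mul_sum]
        simp only [pow_add]
      have h1 : factorsCoeff t m (k + 1) * (geomFactorial t (k + 1) * geomFactorial t (m - k)) =
          (-1) ^ (k + 1) * t ^ (k + 1 + 1).choose 2 * geomFactorial t m *
            ∑ j ∈ range (m - k), t ^ j := by
        -- For k = m both sides vanish: the coefficient lies beyond the degree and the geometric sum
        -- is empty.
        rcases hk'.eq_or_lt with rfl | hlt
        · simp [factorsCoeff_of_lt t k (k + 1) (by omega)]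
        · rw [← ih (k + 1) hlt, show m - k = m - (k + 1) + 1 by omega, geomFactorial_succ t (m - _)]
          ring
      rw [sub_mul, h1, geomFactorial_succ t m, hsum, hch, geomFactorial_succ t k]
      have hpow : t ^ (m + 1) = t ^ (m - k) * t ^ (k + 1) := by
        rw [← pow_add]; congr 1; omega
      rw [hpow]
      linear_combination -(t ^ (m - k) * t ^ (k + 1) * ∑ j ∈ range (k + 1), t ^ j) * h2

theorem applyFactors_eq_sum {K : Type*} [Field K] {n : ℕ} (q t : K) (f : (Fin n → K) → K) (m : ℕ) :
    ∀ x, applyFactors q t f m x =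
      ∑ k ∈ range (m + 1), factorsCoeff t m k * f ((shift q)^[k] x) := by
  induction m with
  | zero => intro x; simp [applyFactors, factorsCoeff]
  | succ m ih =>
    intro x
    simp only [applyFactors, tau, ih]
    rw [sum_range_succ' _ (m + 1)]
    simp only [factorsCoeff, sub_mul, sum_sub_distrib, Function.iterate_zero, id]
    rw [sum_range_succ' _ m, sum_range_succ (fun k => factorsCoeff t m (k + 1) * _) m,
      factorsCoeff_of_lt t m (m + 1) (by omega), mul_sum]
    simp only [Function.iterate_succ_apply, Function.iterate_zero, id, mul_assoc]
    ring

theorem shift_zero_iterate_apply {K : Type*} [Field K] {n : ℕ} (x : Fin n → K) (k : ℕ) (i : Fin n) :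
    (shift 0)^[k] x i = if h : (i : ℕ) + k < n then x ⟨i + k, h⟩ else 0 := by
  induction k generalizing x with
  | zero => simp
  | succ k ih =>
    rw [Function.iterate_succ_apply, ih]
    by_cases h : (i : ℕ) + (k + 1) < n
    · rw [dif_pos h, dif_pos (by omega)]
      simp only [shift]
      rw [dif_pos (by omega)]
      rfl
    · rw [dif_neg h]
      split_ifs with h'
      · simp only [shift]
        rw [dif_neg (by omega), zero_mul]
      · rfl

/-- The first k letters are dropped, and the zeros filling the end are invisible since h 0 = 1. -/
theorem prod_shift_zero_iterate {K : Type*} [Field K] {n : ℕ} (x : Fin n → K) (h : K → K)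
    (h0 : h 0 = 1) (k : ℕ) (hk : k ≤ n) :
    ∏ i, h ((shift 0)^[k] x i) = ∏ i : Fin n, if k ≤ (i : ℕ) then h (x i) else 1 := by
  obtain ⟨d, rfl⟩ := Nat.exists_eq_add_of_le' hk
  rw [Fin.prod_univ_add]
  have h1 : ∀ i : Fin d, h ((shift 0)^[k] x (Fin.castAdd k i)) = h (x ⟨i + k, by omega⟩) := by
    intro i
    rw [shift_zero_iterate_apply, dif_pos (by simp)]
    rfl
  have h2 : ∀ i : Fin k, h ((shift 0)^[k] x (Fin.natAdd d i)) = 1 := by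
    intro i
    rw [shift_zero_iterate_apply, dif_neg (by simp), h0]
  simp only [h1, h2, prod_const_one, mul_one]
  rw [← Equiv.prod_comp (finCongr (Nat.add_comm k d)), Fin.prod_univ_add]
  have h3 : ∀ i : Fin k, ¬ k ≤ ((finCongr (Nat.add_comm k d) (Fin.castAdd d i) : Fin _) : ℕ) := by
    intro i; simp
  have h4 : ∀ i : Fin d, k ≤ ((finCongr (Nat.add_comm k d) (Fin.natAdd k i) : Fin _) : ℕ) := by
    intro i; simp
  simp only [h3, h4, if_true, if_false, prod_const_one, one_mul]
  refine prod_congr rfl fun i _ => ?_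
  congr 2
  ext
  simp [Nat.add_comm]

/-- The left-hand side of the main identity, as a sum over subsets of the letters. -/
theorem eulerPoincare_applyFactors_zero {K : Type*} [Field K] {n : ℕ} (t : K) (x : Fin n → K)
    (h : K → K) (h0 : h 0 = 1) (hx : Function.Injective x) (hx0 : ∀ i, x i ≠ 0) :
    eulerPoincare t (applyFactors 0 t (fun x => ∏ i, h (x i)) n) x =
      geomFactorial t n * ∑ k ∈ range (n + 1), (-1) ^ k * t ^ (k + 1).choose 2 *
        subsetSum (fun a b => (t * x a - x b) / (x a - x b)) (fun a => h (x a)) univ k := by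
  simp only [eulerPoincare, applyFactors_eq_sum, sum_mul, mul_sum]
  rw [sum_comm]
  refine sum_congr rfl fun k hk => ?_
  have hk' : k ≤ n := Nat.lt_succ_iff.1 (mem_range.1 hk)
  simp only [prod_shift_zero_iterate _ h h0 k hk', mul_assoc, ← mul_sum]
  have := sum_perm_eq_subsetSum (fun a b => (t * x a - x b) / (x a - x b)) (fun a => h (x a)) t
    (sum_prod_erase_mul_sub_div_sub t x hx hx0) n k id hk' Function.injective_id
  rw [image_id] at this
  simp only [id] at this
  simp only [Function.comp_apply, this]
  have hcoeff := factorsCoeff_mul_geomFactorial t n k hk'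
  linear_combination subsetSum (fun a b => (t * x a - x b) / (x a - x b)) (fun a => h (x a)) univ k
    * hcoeff

/-! ### Vandermonde products and the Gaudin determinant -/

theorem prod_Ioi_mul_eq_prod_pow {K : Type*} [Field K] {n : ℕ} (x : Fin n → K) :
    ∏ i : Fin n, ∏ j ∈ Ioi i, (x i * x j) = (∏ i, x i) ^ (n - 1) := by
  rw [prod_prod_Ioi_mul_eq_prod_prod_off_diag fun _ i => x i]
  simp only [prod_const, card_compl, card_singleton, Fintype.card_fin, prod_pow]

/-- The pairs inside `T` contribute a power of `t`. -/
theorem prod_filter_lt_const {K α : Type*} [Field K] [LinearOrder α] (t : K) (T : Finset α) :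
    ∏ i ∈ T, ∏ _j ∈ T with i < _j, t = t ^ (#T).choose 2 := by
  induction T using Finset.induction_on_min with
  | empty => simp
  | insert a S ha ih =>
    have haS : a ∉ S := fun h => lt_irrefl _ (ha a h)
    have h1 : {j ∈ insert a S | a < j} = S := by
      ext j
      simp only [mem_filter, mem_insert]
      constructor
      · rintro ⟨rfl | h, h'⟩
        · exact absurd h' (lt_irrefl _)
        · exact h
      · exact fun h => ⟨Or.inr h, ha j h⟩
    have h2 : ∀ i ∈ S, {j ∈ insert a S | i < j} = {j ∈ S | i < j} := by
      intro i hi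
      rw [filter_insert, if_neg (ha i hi).not_gt]
    rw [prod_insert haS, h1, card_insert_of_notMem haS, Nat.choose_succ_succ' _ 1,
      Nat.choose_one_right, pow_add, ← ih, prod_const]
    congr 1
    exact prod_congr rfl fun i hi => by rw [h2 i hi]

/-- Effect on the Vandermonde product of multiplying by `t` the letters indexed by `T`. -/
theorem prod_Ioi_scaled_sub {K : Type*} [Field K] {n : ℕ} (t : K) (x : Fin n → K)
    (hx : Function.Injective x) (T : Finset (Fin n)) :
    ∏ i : Fin n, ∏ j ∈ Ioi i, ((if i ∈ T then t * x i else x i) - (if j ∈ T then t * x j else x j)) =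
      (∏ i : Fin n, ∏ j ∈ Ioi i, (x i - x j)) * t ^ (#T).choose 2 *
        ∏ a ∈ T, ∏ b ∈ univ \ T, (t * x a - x b) / (x a - x b) := by
  -- A pair i < j may cross from `T` to its complement in either direction, hence the factor g i j *
  -- g j i below.
  let g : Fin n → Fin n → K := fun a b =>
    if a ∈ T then if b ∈ T then 1 else (t * x a - x b) / (x a - x b) else 1
  have hfac : ∀ i : Fin n, ∀ j ∈ Ioi i,
      (if i ∈ T then t * x i else x i) - (if j ∈ T then t * x j else x j) =
        (x i - x j) * (if i ∈ T then if j ∈ T then t else 1 else 1) * (g i j * g j i) := by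
    intro i j hj
    have hne : i ≠ j := (mem_Ioi.1 hj).ne
    have h1 : x i - x j ≠ 0 := sub_ne_zero.2 fun h => hne (hx h)
    have h2 : x j - x i ≠ 0 := sub_ne_zero.2 fun h => hne (hx h).symm
    by_cases hi : i ∈ T <;> by_cases hj : j ∈ T <;> simp only [g, hi, hj, if_true, if_false]
    · ring
    · rw [mul_one, mul_one, mul_div_cancel₀ _ h1]
    · rw [mul_one, one_mul, ← neg_sub (x j) (x i), neg_mul, mul_div_cancel₀ _ h2, neg_sub]
    · ring
  have hg : ∏ i : Fin n, ∏ j ∈ Ioi i, (g i j * g j i) =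
      ∏ a ∈ T, ∏ b ∈ univ \ T, (t * x a - x b) / (x a - x b) := by
    rw [prod_prod_Ioi_mul_eq_prod_prod_off_diag fun i j => g j i,
      ← prod_subset (subset_univ T) (f := fun i => ∏ j ∈ {i}ᶜ, g i j)]
    · refine prod_congr rfl fun a ha => ?_
      symm
      refine prod_subset_one_on_sdiff (fun b hb => ?_) (fun b hb => ?_) (fun b hb => ?_)
      · rw [mem_compl, mem_singleton]
        rintro rfl
        exact (mem_sdiff.1 hb).2 ha
      · have : b ∈ T := by
          by_contra h
          exact (mem_sdiff.1 hb).2 (mem_sdiff.2 ⟨mem_univ _, h⟩)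
        simp [g, this]
      · simp [g, ha, (mem_sdiff.1 hb).2]
    · intro i _ hi
      simp [g, hi]
  have ht : ∏ i : Fin n, ∏ j ∈ Ioi i, (if i ∈ T then if j ∈ T then t else 1 else 1) =
      t ^ (#T).choose 2 := by
    rw [← prod_filter_lt_const, ← prod_subset (subset_univ T)]
    · refine prod_congr rfl fun i hi => ?_
      simp only [hi, if_true]
      rw [← prod_filter]
      refine prod_congr ?_ fun _ _ => rfl
      ext j
      simp [and_comm]
    · intro i _ hi
      simp [hi]
  rw [prod_congr rfl fun i _ => prod_congr rfl (hfac i)]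
  simp only [prod_mul_distrib] at hg ⊢
  rw [ht, hg]

/-- Partial fractions in each row, then multilinearity. The rows in `T` contribute (-t)^#T and the
Vandermonde t^(#T choose 2), which combine to the exponent (#T + 1) choose 2. -/
theorem det_one_div_mul_expansion {K : Type*} [Field K] {n : ℕ} (t : K) (x y : Fin n → K)
    (hx : Function.Injective x) (hxy : ∀ i j, 1 - x i * y j ≠ 0)
    (htxy : ∀ i j, 1 - t * (x i * y j) ≠ 0) :
    (1 - t) ^ n * Matrix.det (Matrix.of fun i j : Fin n =>
        1 / ((1 - x i * y j) * (1 - t * (x i * y j)))) =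
      (∏ i : Fin n, ∏ j ∈ Ioi i, (x i - x j)) * (∏ i : Fin n, ∏ j ∈ Ioi i, (y i - y j)) /
          (∏ i, ∏ j, (1 - t * (x i * y j))) *
        ∑ k ∈ range (n + 1), (-1) ^ k * t ^ (k + 1).choose 2 *
          subsetSum (fun a b => (t * x a - x b) / (x a - x b))
            (fun a => ∏ j, (1 - t * (x a * y j)) / (1 - x a * y j)) univ k := by
  have hscale : (1 - t) ^ n * Matrix.det (Matrix.of fun i j : Fin n =>
        1 / ((1 - x i * y j) * (1 - t * (x i * y j)))) =
      Matrix.detRowAlternating ((fun i j => -t * (1 / (1 - t * (x i * y j)))) +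
        (fun i j => 1 / (1 - x i * y j)) : Fin n → Fin n → K) := by
    have := Matrix.det_mul_column (fun _ : Fin n => 1 - t) (Matrix.of fun i j : Fin n =>
        1 / ((1 - x i * y j) * (1 - t * (x i * y j))))
    rw [prod_const, card_univ, Fintype.card_fin] at this
    rw [← this]
    change Matrix.detRowAlternating _ = _
    congr 1
    ext i j
    have h1 := hxy i j
    have h2 := htxy i j
    simp only [Matrix.of_apply, Pi.add_apply]
    rw [mul_one_div, mul_one_div, div_add_div _ _ h2 h1,
      div_eq_div_iff (mul_ne_zero h1 h2) (mul_ne_zero h2 h1)]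
    ring
  have hterm : ∀ T : Finset (Fin n),
      Matrix.detRowAlternating (T.piecewise (fun i j => -t * (1 / (1 - t * (x i * y j))))
        (fun i j => 1 / (1 - x i * y j)) : Fin n → Fin n → K) =
      (∏ i : Fin n, ∏ j ∈ Ioi i, (x i - x j)) * (∏ i : Fin n, ∏ j ∈ Ioi i, (y i - y j)) /
          (∏ i, ∏ j, (1 - t * (x i * y j))) *
        ((-1) ^ #T * t ^ (#T + 1).choose 2 *
          ((∏ a ∈ T, ∏ b ∈ univ \ T, (t * x a - x b) / (x a - x b)) *
            ∏ b ∈ univ \ T, ∏ j, (1 - t * (x b * y j)) / (1 - x b * y j))) := by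
    intro T
    let a : Fin n → K := fun i => if i ∈ T then t * x i else x i
    have ha : ∀ i j, 1 - a i * y j ≠ 0 := by
      intro i j
      by_cases hi : i ∈ T
      · simpa only [a, hi, if_true, mul_assoc] using htxy i j
      · simpa only [a, hi, if_false] using hxy i j
    have hmat : (T.piecewise (fun i j => -t * (1 / (1 - t * (x i * y j))))
        (fun i j => 1 / (1 - x i * y j)) : Fin n → Fin n → K) = Matrix.of fun i j =>
          (if i ∈ T then -t else 1) *
            (Matrix.of (fun i j => 1 / (1 - a i * y j)) : Matrix (Fin n) (Fin n) K) i j := by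
      ext i j
      by_cases hi : i ∈ T
      · simp [a, hi, mul_assoc]
      · simp [a, hi]
    have hpre : ∏ i : Fin n, (if i ∈ T then -t else 1) = (-1) ^ #T * t ^ #T := by
      rw [prod_ite_mem, univ_inter, prod_const, neg_pow]
    -- Relative to the common denominator, the Cauchy denominator lacks exactly the kernel of the
    -- letters outside `T`.
    have hden : (∏ i, ∏ j, (1 - t * (x i * y j))) =
        (∏ i, ∏ j, (1 - a i * y j)) *
          ∏ b ∈ univ \ T, ∏ j, (1 - t * (x b * y j)) / (1 - x b * y j) := by
      rw [← prod_sdiff (subset_univ T), ← prod_sdiff (subset_univ T) (f := fun i => ∏ j, _),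
        mul_right_comm, ← prod_mul_distrib]
      congr 1
      · refine prod_congr rfl fun i hi => ?_
        rw [← prod_mul_distrib]
        refine prod_congr rfl fun j _ => ?_
        simp only [a, (mem_sdiff.1 hi).2, if_false]
        rw [mul_div_cancel₀ _ (hxy i j)]
      · refine prod_congr rfl fun i hi => prod_congr rfl fun j _ => ?_
        simp only [a, hi, if_true, mul_assoc]
    have hh : ∏ b ∈ univ \ T, ∏ j, (1 - t * (x b * y j)) / (1 - x b * y j) ≠ 0 :=
      prod_ne_zero_iff.2 fun i _ => prod_ne_zero_iff.2 fun j _ => div_ne_zero (htxy i j) (hxy i j)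
    have hA : ∏ i, ∏ j, (1 - a i * y j) ≠ 0 :=
      prod_ne_zero_iff.2 fun i _ => prod_ne_zero_iff.2 fun j _ => ha i j
    have hvan := prod_Ioi_scaled_sub t x hx T
    change ∏ i : Fin n, ∏ j ∈ Ioi i, (a i - a j) = _ at hvan
    rw [hmat]
    change Matrix.det _ = _
    rw [Matrix.det_mul_column, det_one_div_one_sub_mul n a y ha, hpre, hvan, hden,
      Nat.choose_succ_succ' _ 1, Nat.choose_one_right, pow_add]
    generalize (∏ b ∈ univ \ T, ∏ j, (1 - t * (x b * y j)) / (1 - x b * y j)) = H at *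
    generalize ∏ i, ∏ j, (1 - a i * y j) = A at *
    rw [mul_div_assoc', div_mul_eq_mul_div, div_eq_div_iff hA (mul_ne_zero hA hh)]
    ring
  rw [hscale]
  have hexp := (Matrix.detRowAlternating (n := Fin n) (R := K)).toMultilinearMap.map_add_univ
    (fun i j => -t * (1 / (1 - t * (x i * y j)))) (fun i j => 1 / (1 - x i * y j))
  refine hexp.trans ?_
  refine (sum_congr rfl fun T _ => hterm T).trans ?_
  rw [← mul_sum]
  congr 1
  rw [← powerset_univ, sum_powerset]
  simp only [card_univ, Fintype.card_fin]
  refine sum_congr rfl fun k _ => ?_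
  rw [subsetSum, mul_sum]
  refine sum_congr rfl fun T hT => ?_
  rw [(mem_powersetCard.1 hT).2]

theorem gaudinTilde_eq {K : Type*} [Field K] {n : ℕ} (t : K) (x y : Fin n → K)
    (hx0 : ∀ i, x i ≠ 0) :
    gaudinTilde t x y =
      (∏ i, ∏ j, (1 - x i * y j)) * (∏ i, ∏ j, (1 - t * (x i * y j))) /
        ((∏ i : Fin n, ∏ j ∈ Ioi i, (x i - x j)) * (∏ i : Fin n, ∏ j ∈ Ioi i, (y i - y j))) *
        Matrix.det (Matrix.of fun i j : Fin n =>
          1 / ((1 - x i * y j) * (1 - t * (x i * y j)))) := by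
  have hX : ∏ i, x i ≠ 0 := prod_ne_zero_iff.2 fun i _ => hx0 i
  have hentry : ∀ i j, ∏ k ∈ range (1 + 1), ((x i)⁻¹ - t ^ k * y j) =
      (1 - x i * y j) * (1 - t * (x i * y j)) / x i ^ 2 := by
    intro i j
    have := hx0 i
    rw [prod_range_succ, prod_range_one]
    field_simp
  have hdet : Matrix.det (Matrix.of fun i j : Fin n =>
        1 / ((1 - x i * y j) * (1 - t * (x i * y j)) / x i ^ 2)) =
      (∏ i, x i) ^ 2 * Matrix.det (Matrix.of fun i j : Fin n =>
          1 / ((1 - x i * y j) * (1 - t * (x i * y j)))) := by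
    rw [← prod_pow, ← Matrix.det_mul_column]
    congr 1
    ext i j
    simp only [Matrix.of_apply]
    rw [one_div_div, mul_one_div]
  have hvan : ∏ i : Fin n, ∏ j ∈ Ioi i, ((x j)⁻¹ - (x i)⁻¹) =
      (∏ i : Fin n, ∏ j ∈ Ioi i, (x i - x j)) / (∏ i, x i) ^ (n - 1) := by
    rw [← prod_Ioi_mul_eq_prod_pow, ← prod_div_distrib]
    refine prod_congr rfl fun i _ => ?_
    rw [← prod_div_distrib]
    refine prod_congr rfl fun j _ => ?_
    rw [inv_sub_inv (hx0 j) (hx0 i), mul_comm (x i)]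
  simp only [gaudinTilde, gaudin, hentry, hvan, hdet]
  simp only [prod_div_distrib, prod_mul_distrib, prod_const, card_univ, Fintype.card_fin, prod_pow]
  generalize Matrix.det (_ : Matrix (Fin n) (Fin n) K) = D
  generalize ∏ i, ∏ j, (1 - x i * y j) = N
  generalize ∏ i, ∏ j, (1 - t * (x i * y j)) = M
  generalize ∏ i : Fin n, ∏ j ∈ Ioi i, (x i - x j) = V
  generalize ∏ i : Fin n, ∏ j ∈ Ioi i, (y i - y j) = W
  -- The powers of ∏ x_i cancel by 2n = 2(n - 1) + 2, which fails for n = 0 under truncated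
  -- subtraction.
  rcases n with _ | n
  · simp
  · generalize ∏ i, x i = X at *
    rw [Nat.add_sub_cancel]
    have h : ((X ^ 2) ^ (n + 1))⁻¹ * (X ^ n * X ^ n * X ^ 2) = 1 := by
      rw [← pow_mul, ← pow_add, ← pow_add, show 2 * (n + 1) = n + n + 2 by ring]
      exact inv_mul_cancel₀ (pow_ne_zero _ hX)
    simp only [div_eq_mul_inv, mul_inv, inv_inv]
    linear_combination N * M * V⁻¹ * W⁻¹ * D * h

end Lascoux

theorem theorem4 {K : Type*} [Field K] (n : ℕ) (t : K) (x y : Fin n → K)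
    (hx : Function.Injective x) (hy : Function.Injective y)
    (hx0 : ∀ i, x i ≠ 0)
    (hxy : ∀ i j, x i * y j ≠ 1) (htxy : ∀ i j, t * (x i * y j) ≠ 1) :
    Lascoux.eulerPoincare t
        (Lascoux.applyFactors 0 t (Lascoux.hallLittlewoodKernel t y) n) x =
      Lascoux.cauchyKernel y x * Lascoux.gaudinTilde t x y * Lascoux.qFactorial t n := by
  have h1 : ∀ i j, 1 - x i * y j ≠ 0 := fun i j => sub_ne_zero.2 (hxy i j).symm
  have h2 : ∀ i j, 1 - t * (x i * y j) ≠ 0 := fun i j => sub_ne_zero.2 (htxy i j).symm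
  have hL := Lascoux.eulerPoincare_applyFactors_zero t x
    (fun a => ∏ j, (1 - t * (a * y j)) / (1 - a * y j)) (by simp) hx hx0
  have hR := Lascoux.det_one_div_mul_expansion t x y hx h1 h2
  rw [show Lascoux.hallLittlewoodKernel t y = fun x => ∏ i, ∏ j, (1 - t * (x i * y j)) / (1 - x i * y j)
    from rfl, hL]
  clear hL
  rw [Lascoux.gaudinTilde_eq t x y hx0, Lascoux.qFactorial_eq, Lascoux.cauchyKernel]
  simp only [prod_div_distrib, prod_const_one] at hR ⊢
  have hN : ∏ i, ∏ j, (1 - x i * y j) ≠ 0 :=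
    prod_ne_zero_iff.2 fun i _ => prod_ne_zero_iff.2 fun j _ => h1 i j
  have hM : ∏ i, ∏ j, (1 - t * (x i * y j)) ≠ 0 :=
    prod_ne_zero_iff.2 fun i _ => prod_ne_zero_iff.2 fun j _ => h2 i j
  have hV : ∏ i : Fin n, ∏ j ∈ Ioi i, (x i - x j) ≠ 0 :=
    prod_ne_zero_iff.2 fun i _ => prod_ne_zero_iff.2 fun j hj =>
      sub_ne_zero.2 fun h => (mem_Ioi.1 hj).ne (hx h)
  have hW : ∏ i : Fin n, ∏ j ∈ Ioi i, (y i - y j) ≠ 0 :=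
    prod_ne_zero_iff.2 fun i _ => prod_ne_zero_iff.2 fun j hj =>
      sub_ne_zero.2 fun h => (mem_Ioi.1 hj).ne (hy h)
  generalize Matrix.det (_ : Matrix (Fin n) (Fin n) K) = D at *
  generalize ∏ i, ∏ j, (1 - x i * y j) = N at *
  generalize ∏ i, ∏ j, (1 - t * (x i * y j)) = M at *
  generalize ∏ i : Fin n, ∏ j ∈ Ioi i, (x i - x j) = V at *
  generalize ∏ i : Fin n, ∏ j ∈ Ioi i, (y i - y j) = W at *
  generalize (∑ k ∈ range (n + 1), _ : K) = S at *
  -- The factor (1 - t)^n of [n]! stays with the determinant, so nothing is divided by 1 - t and t =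
  -- 1 is allowed.
  have hD : S = M / (V * W) * ((1 - t) ^ n * D) := by
    rw [hR, ← mul_assoc, div_mul_div_cancel₀ (mul_ne_zero hV hW), div_self hM, one_mul]
  rw [hD]
  calc _ = N / N * (M / (V * W) * D * ((1 - t) ^ n * Lascoux.geomFactorial t n)) := by
        rw [div_self hN]; ring
    _ = _ := by ring
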